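/- Let $\Phi$ be the standard normal distribution function and $R(a)=\frac{\Phi(a)}{1-\Phi(a)}$. Let $\mu>0$, $\sigma>0$, and let $V_1,V_2,\dots$ be independent normal random variables with mean $\mu$ and variance $2\sigma^2$; put $S_m=\sum_{i=1}^m V_i$. For $c>0$ let $$\tau=\min\{m\ge 1:\ S_m<-c\ \text{ or }\ S_m>c\}.$$ Then $\tau<\infty$ almost surely and, for every $c>0$, $$\frac{e^{\mu c/\sigma^2}-1}{e^{\mu c/\sigma^2}-R\!\left(-\frac{\mu}{\sigma\sqrt2}\right)e^{-\mu c/\sigma^2}}\;<\;\mathbb P(S_\tau>c)\;<\;\frac{e^{\mu c/\sigma^2}\,R\!\left(\frac{\mu}{\sigma\sqrt2}\right)-1}{e^{\mu c/\sigma^2}\,R\!\left(\frac{\mu}{\sigma\sqrt2}\right)-e^{-\mu c/\sigma^2}} .$$ Moreover, $\mathbb E[\tau]<\infty$ and $$\mathbb E[\tau]\approx\frac{2c\,(e^{\mu c/\sigma^2}-1)}{\mu\,(e^{\mu c/\sigma^2}-e^{-\mu c/\sigma^2})}-\frac c\mu ,$$ in the sense that the absolute difference of the two sides is at most a constant $K$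 that depends only on $\mu$ and $\sigma$ (not on $c$). -/

import Mathlib

open MeasureTheory ProbabilityTheory
open scoped ENNReal NNReal

noncomputable section

/-- The standard normal distribution function `Φ`. -/
def stdNormalCdf (x : ℝ) : ℝ := cdf (gaussianReal 0 1) x

/-- The ratio `R(a) = Φ(a) / (1 - Φ(a))`. -/
def normalOdds (a : ℝ) : ℝ := stdNormalCdf a / (1 - stdNormalCdf a)

/-- The partial sums `S_m`, the sum of the first `m` steps (steps are indexed from `0`). -/
def partialSum {Ω : Type*} (V : ℕ → Ω → ℝ) (m : ℕ) (ω : Ω) : ℝ :=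
  ∑ i ∈ Finset.range m, V i ω

/-- The first time `m ≥ 1` with `S_m < -c` or `S_m > c`; it is `⊤` if there is none. -/
def exitTime {Ω : Type*} (V : ℕ → Ω → ℝ) (c : ℝ) : Ω → ℕ∞ :=
  hittingAfter (partialSum V) {x : ℝ | x < -c ∨ c < x} 1

/-- The event `S_τ > c`: the exit time is finite, and the sum at that time exceeds `c`. -/
def upperExit {Ω : Type*} (V : ℕ → Ω → ℝ) (c : ℝ) : Set Ω :=
  {ω | exitTime V c ω ≠ ⊤ ∧ c < stoppedValue (partialSum V) (exitTime V c) ω}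

/-- The expected value of the exit time, as an extended nonnegative real. -/
def expectedExitTime {Ω : Type*} [MeasurableSpace Ω] (P : Measure Ω) (V : ℕ → Ω → ℝ)
    (c : ℝ) : ℝ≥0∞ :=
  ∫⁻ ω, (exitTime V c ω : ℝ≥0∞) ∂P

/-- The value of the expected exit time obtained by neglecting the excess over the barriers. -/
def approxExitTime (μ σ c : ℝ) : ℝ :=
  2 * c * (Real.exp (μ * c / σ ^ 2) - 1) /
      (μ * (Real.exp (μ * c / σ ^ 2) - Real.exp (-(μ * c / σ ^ 2)))) - c / μ

end

/-! Write v = 2σ², λ = 2μ/v = μ/σ², e = exp(λc), and let P, Q be the probabilities of leaving above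
and below. Since E exp(-λV) = 1, optional stopping of exp(-λS) gives A + B = 1, where A and B are
the contributions of the two exits, while P + Q = 1. Crossing the barriers strictly gives A < P/e
and B > eQ.

The opposite bounds need control of the excess. Given the last position x ≤ c, the excess over c is
a normal variable with mean μ - (c - x), conditioned to be positive. Lowering the mean tilts the
density by a decreasing exponential, so by Chebyshev's inequality the conditional mean of a monotone
function is largest at x = c (`setIntegral_Ioi_conv_gaussianReal_le`). With G, H the masses of
N(μ,v) and N(-μ,v) on (0,∞), this yields A ≥ (H/G)P/e and B ≤ (G/H)eQ; here G/H = R(μ/(σ√2)).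
Solving A + B = 1 for P gives both probability bounds.

The same comparison bounds the mean excess uniformly in c. Wald's identity then puts μE[τ] within a
constant of c(2P - 1), and Q ≤ 1/e makes replacing P by e/(e + 1) cost only a bounded amount. All
this is proved for the law of the walk killed at exit (`killedLaw_exit`) and then transferred to the
exit time. -/

/-! ### Comparison of excesses for shifted normal laws. -/

/-- Chebyshev's association inequality: a monotone and an antitone function are negatively
correlated. -/
theorem integral_mul_mul_measureReal_univ_le {ν : Measure ℝ} [IsFiniteMeasure ν] {s : Set ℝ}
    (hs : ∀ᵐ x ∂ν, x ∈ s) {f g : ℝ → ℝ} (hf : MonotoneOn f s) (hg : AntitoneOn g s)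
    (hfi : Integrable f ν) (hgi : Integrable g ν) (hfg : Integrable (fun x => f x * g x) ν) :
    (∫ x, f x * g x ∂ν) * ν.real Set.univ ≤ (∫ x, f x ∂ν) * ∫ x, g x ∂ν := by
  -- Take two independent copies: the integrand has a constant sign by monotonicity, and expanding
  -- it gives twice the claim.
  have h0 : 0 ≤ ∫ z : ℝ × ℝ, (f z.1 - f z.2) * (g z.2 - g z.1) ∂(ν.prod ν) := by
    apply integral_nonneg_of_ae
    have h1 : ∀ᵐ z : ℝ × ℝ ∂(ν.prod ν), z.1 ∈ s := Measure.quasiMeasurePreserving_fst.ae hs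
    have h2 : ∀ᵐ z : ℝ × ℝ ∂(ν.prod ν), z.2 ∈ s := Measure.quasiMeasurePreserving_snd.ae hs
    filter_upwards [h1, h2] with z hz1 hz2
    rcases le_total z.1 z.2 with h | h
    · exact mul_nonneg_of_nonpos_of_nonpos (sub_nonpos.2 (hf hz1 hz2 h))
        (sub_nonpos.2 (hg hz1 hz2 h))
    · exact mul_nonneg (sub_nonneg.2 (hf hz2 hz1 h)) (sub_nonneg.2 (hg hz2 hz1 h))
  have i1 : Integrable (fun z : ℝ × ℝ => f z.1 * g z.2) (ν.prod ν) := hfi.mul_prod hgi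
  have i2 : Integrable (fun z : ℝ × ℝ => g z.1 * f z.2) (ν.prod ν) := hgi.mul_prod hfi
  have i3 : Integrable (fun z : ℝ × ℝ => (f z.1 * g z.1) * 1) (ν.prod ν) :=
    hfg.mul_prod (integrable_const (1 : ℝ))
  have i4 : Integrable (fun z : ℝ × ℝ => 1 * (f z.2 * g z.2)) (ν.prod ν) :=
    (integrable_const (1 : ℝ)).mul_prod hfg
  have e : ∀ z : ℝ × ℝ, (f z.1 - f z.2) * (g z.2 - g z.1)
      = (f z.1 * g z.2 + g z.1 * f z.2) - ((f z.1 * g z.1) * 1 + 1 * (f z.2 * g z.2)) :=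
    fun z => by ring
  simp_rw [e] at h0
  rw [integral_sub (by exact i1.add i2) (by exact i3.add i4), integral_add i1 i2, integral_add i3 i4,
    integral_prod_mul f g, integral_prod_mul g f, integral_prod_mul (fun x => f x * g x) fun _ => 1,
    integral_prod_mul (fun _ => (1 : ℝ)) fun x => f x * g x] at h0
  simp only [integral_const, smul_eq_mul, mul_one] at h0
  linarith

theorem gaussianPDFReal_sub_mean (m r : ℝ) {v : ℝ≥0} (hv : v ≠ 0) (x : ℝ) :
    gaussianPDFReal (m - r) v x =
      Real.exp (r * m / v - r ^ 2 / (2 * v)) * (gaussianPDFReal m v x * Real.exp (-(r / v) * x)) := by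
  have hv' : (v : ℝ) ≠ 0 := by exact_mod_cast hv
  simp only [gaussianPDFReal]
  have h : Real.exp (-(x - (m - r)) ^ 2 / (2 * v)) = Real.exp (r * m / v - r ^ 2 / (2 * v)) *
      (Real.exp (-(x - m) ^ 2 / (2 * v)) * Real.exp (-(r / v) * x)) := by
    rw [← Real.exp_add, ← Real.exp_add]
    congr 1
    field_simp
    ring
  rw [h]
  ring

theorem setIntegral_gaussianReal_sub_mean (m r : ℝ) {v : ℝ≥0} (hv : v ≠ 0) (f : ℝ → ℝ)
    {s : Set ℝ} (hs : MeasurableSet s) :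
    ∫ x in s, f x ∂(gaussianReal (m - r) v) = Real.exp (r * m / v - r ^ 2 / (2 * v)) *
      ∫ x in s, f x * Real.exp (-(r / v) * x) ∂(gaussianReal m v) := by
  rw [← integral_indicator hs, ← integral_indicator hs,
    integral_gaussianReal_eq_integral_smul hv, integral_gaussianReal_eq_integral_smul hv,
    ← integral_const_mul]
  congr 1 with x
  by_cases hx : x ∈ s
  · simp only [hx, Set.indicator_of_mem, smul_eq_mul, gaussianPDFReal_sub_mean m r hv]
    ring
  · simp [hx]

/-- For `f` monotone on the half-line, the mean of `f` over the positive part of a normal law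
decreases when the normal law is shifted to the left. -/
theorem setIntegral_Ioi_gaussianReal_sub_mean_le (m : ℝ) {r : ℝ} (hr : 0 ≤ r) {v : ℝ≥0}
    (hv : v ≠ 0) {f : ℝ → ℝ} (hf : MonotoneOn f (Set.Ioi 0))
    (hfi : Integrable f (gaussianReal m v)) :
    (∫ x in Set.Ioi 0, f x ∂(gaussianReal (m - r) v)) * (gaussianReal m v).real (Set.Ioi 0) ≤
      (∫ x in Set.Ioi 0, f x ∂(gaussianReal m v)) * (gaussianReal (m - r) v).real (Set.Ioi 0) := by
  have hrv : 0 ≤ r / (v : ℝ) := div_nonneg hr v.2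
  have h1 : (gaussianReal (m - r) v).real (Set.Ioi 0) =
      ∫ x in Set.Ioi 0, (fun _ => (1 : ℝ)) x ∂(gaussianReal (m - r) v) := by simp
  -- Both shifted integrals carry the same tilting constant, which cancels; what remains is
  -- association of `f` with the decreasing factor exp(-(r/v)x).
  rw [h1, setIntegral_gaussianReal_sub_mean m r hv f measurableSet_Ioi,
    setIntegral_gaussianReal_sub_mean m r hv _ measurableSet_Ioi, mul_assoc,
    mul_left_comm (∫ x in Set.Ioi 0, f x ∂(gaussianReal m v))]
  refine mul_le_mul_of_nonneg_left ?_ (Real.exp_pos _).le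
  simp only [one_mul]
  have := integral_mul_mul_measureReal_univ_le
    (ν := (gaussianReal m v).restrict (Set.Ioi 0)) (s := Set.Ioi 0)
    (ae_restrict_mem measurableSet_Ioi) hf
    (g := fun x => Real.exp (-(r / v) * x)) ?_ hfi.integrableOn
    (integrable_exp_mul_gaussianReal _).integrableOn ?_
  · simpa using this
  · intro x _ y _ hxy
    exact Real.exp_le_exp.2 (by nlinarith)
  · refine hfi.integrableOn.mul_bdd (c := 1) (by fun_prop) ?_
    filter_upwards [ae_restrict_mem measurableSet_Ioi] with x hx
    rw [Real.norm_eq_abs, Real.abs_exp, Real.exp_le_one_iff]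
    have : 0 ≤ r / v * x := mul_nonneg hrv (le_of_lt hx)
    linarith

/-- The excess of a normal random walk over a level: the mean of a monotone function of the excess
is largest when the walk starts from the level. -/
theorem setIntegral_Ioi_conv_gaussianReal_le {ρ : Measure ℝ} [IsFiniteMeasure ρ] {c : ℝ}
    (hρ : ∀ᵐ x ∂ρ, x ≤ c) (m : ℝ) {v : ℝ≥0} (hv : v ≠ 0) {f : ℝ → ℝ}
    (hf : MonotoneOn f (Set.Ioi 0)) (hfi : Integrable f (gaussianReal m v))
    (hfc : Integrable (fun z => f (z - c)) (ρ.conv (gaussianReal m v))) :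
    (∫ z in Set.Ioi c, f (z - c) ∂(ρ.conv (gaussianReal m v))) *
        (gaussianReal m v).real (Set.Ioi 0) ≤
      (∫ x in Set.Ioi 0, f x ∂(gaussianReal m v)) *
        (ρ.conv (gaussianReal m v)).real (Set.Ioi c) := by
  -- Disintegrate over the starting point x; used for `f` and for the constant 1, so that the
  -- comparison can be made pointwise in x.
  have key : ∀ h : ℝ → ℝ, Integrable (fun z => h (z - c)) (ρ.conv (gaussianReal m v)) →
      Integrable (fun x => ∫ u in Set.Ioi 0, h u ∂(gaussianReal (m - (c - x)) v)) ρ ∧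
      ∫ z in Set.Ioi c, h (z - c) ∂(ρ.conv (gaussianReal m v)) =
        ∫ x, ∫ u in Set.Ioi 0, h u ∂(gaussianReal (m - (c - x)) v) ∂ρ := by
    intro h hh
    have hI := hh.indicator (measurableSet_Ioi (a := c))
    have e : ∀ x, ∫ y, (Set.Ioi c).indicator (fun z => h (z - c)) (x + y) ∂(gaussianReal m v)
        = ∫ u in Set.Ioi 0, h u ∂(gaussianReal (m - (c - x)) v) := by
      intro x
      rw [← gaussianReal_map_sub_const (c - x), ← integral_indicator measurableSet_Ioi,
        (measurableEmbedding_subRight (c - x)).integral_map]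
      congr 1 with y
      simp only [Set.indicator, Set.mem_Ioi, sub_pos]
      have : c - x < y ↔ c < x + y := by constructor <;> intro <;> linarith
      simp only [this]
      congr 2
      ring
    constructor
    · have := ((integrable_map_measure hI.1 (by fun_prop)).1 hI).integral_prod_left
      refine this.congr (Filter.Eventually.of_forall fun x => ?_)
      exact e x
    · rw [← integral_indicator measurableSet_Ioi, integral_conv hI]
      simp_rw [e]
  obtain ⟨i1, e1⟩ := key f hfc
  obtain ⟨i2, e2⟩ := key (fun _ => 1) (integrable_const _)
  have e3 : (ρ.conv (gaussianReal m v)).real (Set.Ioi c) =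
      ∫ z in Set.Ioi c, (1 : ℝ) ∂(ρ.conv (gaussianReal m v)) := by simp
  rw [e3, e1, e2, ← integral_mul_const, ← integral_const_mul]
  refine integral_mono_ae (i1.mul_const _) (i2.const_mul _) ?_
  filter_upwards [hρ] with x hx
  simpa using setIntegral_Ioi_gaussianReal_sub_mean_le m (sub_nonneg.2 hx) hv hf hfi

theorem integrable_of_ae_mem_Icc {ρ : Measure ℝ} [IsFiniteMeasure ρ] {c : ℝ}
    (hρ : ∀ᵐ x ∂ρ, x ∈ Set.Icc (-c) c) {f : ℝ → ℝ} (hf : Continuous f) : Integrable f ρ := by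
  obtain ⟨C, hC⟩ := (isCompact_Icc (a := -c) (b := c)).exists_bound_of_continuousOn hf.continuousOn
  refine Integrable.of_bound hf.aestronglyMeasurable C ?_
  filter_upwards [hρ] with x hx using hC x hx

theorem integrable_id_gaussianReal (m : ℝ) (v : ℝ≥0) :
    Integrable (fun x => x) (gaussianReal m v) :=
  memLp_one_iff_integrable.1 (memLp_id_gaussianReal 1)

/-! ### One step of the walk from a law carried by [-c, c]. -/

section OneStep

variable {ρ : Measure ℝ} [IsFiniteMeasure ρ] {c : ℝ}

theorem integrable_exp_mul_conv_gaussianReal (hρ : ∀ᵐ x ∂ρ, x ∈ Set.Icc (-c) c) (m : ℝ)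
    (v : ℝ≥0) (t : ℝ) : Integrable (fun z => Real.exp (t * z)) (ρ.conv (gaussianReal m v)) := by
  refine (integrable_map_measure (by fun_prop) (by fun_prop)).2 ?_
  refine ((integrable_of_ae_mem_Icc hρ (f := fun x => Real.exp (t * x)) (by fun_prop)).mul_prod
    (integrable_exp_mul_gaussianReal (μ := m) (v := v) t)).congr
    (Filter.Eventually.of_forall fun z => ?_)
  simp [mul_add, Real.exp_add]

theorem integrable_id_conv_gaussianReal (hρ : ∀ᵐ x ∂ρ, x ∈ Set.Icc (-c) c) (m : ℝ)
    (v : ℝ≥0) : Integrable (fun z => z) (ρ.conv (gaussianReal m v)) := by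
  refine (integrable_map_measure (by fun_prop) (by fun_prop)).2 ?_
  exact ((integrable_of_ae_mem_Icc hρ continuous_id).comp_fst _).add
    ((integrable_id_gaussianReal m v).comp_snd ρ)

/-- Martingale property: the exponent -2m/v is a root of the equation that sets the normal moment
generating function equal to 1. -/
theorem integral_exp_conv_gaussianReal (hρ : ∀ᵐ x ∂ρ, x ∈ Set.Icc (-c) c) (m : ℝ)
    {v : ℝ≥0} (hv : v ≠ 0) :
    ∫ z, Real.exp (-(2 * m / v) * z) ∂(ρ.conv (gaussianReal m v)) =
      ∫ x, Real.exp (-(2 * m / v) * x) ∂ρ := by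
  have hv' : (v : ℝ) ≠ 0 := by exact_mod_cast hv
  rw [integral_conv (integrable_exp_mul_conv_gaussianReal hρ m v _)]
  congr 1 with x
  simp_rw [mul_add, Real.exp_add]
  rw [integral_const_mul]
  have h : ∫ y, Real.exp (-(2 * m / v) * y) ∂(gaussianReal m v) = 1 := by
    have := congrFun (mgf_id_gaussianReal (μ := m) (v := v)) (-(2 * m / v))
    simp only [mgf, id] at this
    rw [this, Real.exp_eq_one_iff]
    field_simp
    ring
  rw [h, mul_one]

theorem integral_id_conv_gaussianReal (hρ : ∀ᵐ x ∂ρ, x ∈ Set.Icc (-c) c) (m : ℝ) (v : ℝ≥0) :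
    ∫ z, z ∂(ρ.conv (gaussianReal m v)) = ∫ x, x ∂ρ + m * ρ.real Set.univ := by
  rw [integral_conv (integrable_id_conv_gaussianReal hρ m v)]
  have h : ∀ x : ℝ, ∫ y, (x + y) ∂(gaussianReal m v) = x + m := by
    intro x
    rw [integral_add (integrable_const _) (integrable_id_gaussianReal m v),
      integral_id_gaussianReal]
    simp
  simp_rw [h]
  rw [integral_add (by exact integrable_of_ae_mem_Icc hρ continuous_id) (integrable_const _)]
  simp [mul_comm]

theorem map_neg_conv_gaussianReal (m : ℝ) (v : ℝ≥0) :
    (ρ.conv (gaussianReal m v)).map (fun z => -z) =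
      (ρ.map fun x => -x).conv (gaussianReal (-m) v) := by
  rw [← gaussianReal_map_neg]
  exact Measure.map_conv_addMonoidHom (negAddMonoidHom : ℝ →+ ℝ) (by exact measurable_neg)

/-- Reflection z ↦ -z turns the lower barrier into the upper one and changes the drift to -m. -/
theorem setIntegral_Iio_conv_gaussianReal_le (hρ : ∀ᵐ x ∂ρ, x ∈ Set.Icc (-c) c) (m : ℝ)
    {v : ℝ≥0} (hv : v ≠ 0) {f : ℝ → ℝ} (hf : MonotoneOn f (Set.Ioi 0))
    (hfi : Integrable f (gaussianReal (-m) v))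
    (hfc : Integrable (fun z => f (-c - z)) (ρ.conv (gaussianReal m v))) :
    (∫ z in Set.Iio (-c), f (-c - z) ∂(ρ.conv (gaussianReal m v))) *
        (gaussianReal (-m) v).real (Set.Ioi 0) ≤
      (∫ x in Set.Ioi 0, f x ∂(gaussianReal (-m) v)) *
        (ρ.conv (gaussianReal m v)).real (Set.Iio (-c)) := by
  have hpre : (fun z : ℝ => -z) ⁻¹' Set.Ioi c = Set.Iio (-c) := by
    ext z
    simp
  have h := setIntegral_Ioi_conv_gaussianReal_le (ρ := ρ.map fun x => -x) (c := c) ?_ (-m) hv hf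
    hfi ?_
  · rw [← map_neg_conv_gaussianReal, measurableEmbedding_neg.setIntegral_map, hpre,
      map_measureReal_apply measurable_neg measurableSet_Ioi, hpre] at h
    simpa only [neg_sub_left, neg_sub_comm, sub_eq_add_neg, add_comm] using h
  · refine (ae_map_iff (by fun_prop) measurableSet_Iic).2 ?_
    filter_upwards [hρ] with x hx using neg_le.1 hx.1
  · rw [← map_neg_conv_gaussianReal]
    refine (measurableEmbedding_neg.integrable_map_iff).2 (hfc.congr ?_)
    filter_upwards with z
    simp only [Function.comp]
    congr 1
    ring

/-- A shift by 2m takes mean m to -m, and its normalizing constant is exactly 1. This is what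
produces the odds ratio in the final bounds. -/
theorem setIntegral_Ioi_exp_gaussianReal (m : ℝ) {v : ℝ≥0} (hv : v ≠ 0) :
    ∫ u in Set.Ioi 0, Real.exp (-(2 * m / v) * u) ∂(gaussianReal m v) =
      (gaussianReal (-m) v).real (Set.Ioi 0) := by
  have hv' : (v : ℝ) ≠ 0 := by exact_mod_cast hv
  have h := setIntegral_gaussianReal_sub_mean m (2 * m) hv (fun _ => 1) (s := Set.Ioi 0)
    measurableSet_Ioi
  have e : 2 * m * m / v - (2 * m) ^ 2 / (2 * v) = 0 := by
    field_simp
    ring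
  rw [e, show m - 2 * m = -m by ring] at h
  simpa using h.symm

theorem setIntegral_Ioi_exp_gaussianReal_neg (m : ℝ) {v : ℝ≥0} (hv : v ≠ 0) :
    ∫ u in Set.Ioi 0, Real.exp (2 * m / v * u) ∂(gaussianReal (-m) v) =
      (gaussianReal m v).real (Set.Ioi 0) := by
  have h := setIntegral_Ioi_exp_gaussianReal (-m) hv
  rw [neg_neg] at h
  rw [← h]
  congr 1 with u
  congr 1
  ring

/-- Passing over the upper barrier, lower bound for the exponential functional. -/
theorem le_setIntegral_Ioi_exp_conv (hρ : ∀ᵐ x ∂ρ, x ∈ Set.Icc (-c) c) {m : ℝ} (hm : 0 < m)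
    {v : ℝ≥0} (hv : v ≠ 0) :
    Real.exp (-(2 * m / v * c)) * (gaussianReal (-m) v).real (Set.Ioi 0) *
        (ρ.conv (gaussianReal m v)).real (Set.Ioi c) ≤
      (∫ z in Set.Ioi c, Real.exp (-(2 * m / v) * z) ∂(ρ.conv (gaussianReal m v))) *
        (gaussianReal m v).real (Set.Ioi 0) := by
  have h0 : 0 ≤ 2 * m / (v : ℝ) := by positivity
  have e : ∀ z, -Real.exp (-(2 * m / v) * (z - c)) =
      -Real.exp (2 * m / v * c) * Real.exp (-(2 * m / v) * z) := by
    intro z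
    rw [neg_mul (Real.exp _), ← Real.exp_add]
    congr 2
    ring
  -- The exponential is decreasing, so its negative is the monotone function; this reverses the
  -- inequality into a lower bound.
  have h := setIntegral_Ioi_conv_gaussianReal_le (hρ.mono fun x hx => hx.2) m hv
    (f := fun u => -Real.exp (-(2 * m / v) * u))
    (fun x _ y _ hxy => neg_le_neg (Real.exp_le_exp.2 (by nlinarith)))
    (integrable_exp_mul_gaussianReal _).neg
    (by simp_rw [e]; exact (integrable_exp_mul_conv_gaussianReal hρ m v _).const_mul _)
  simp_rw [e, integral_const_mul, integral_neg] at h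
  rw [setIntegral_Ioi_exp_gaussianReal m hv] at h
  rw [Real.exp_neg, mul_assoc, inv_mul_le_iff₀ (Real.exp_pos _)]
  linarith

/-- Passing over the lower barrier, upper bound for the exponential functional. -/
theorem setIntegral_Iio_exp_conv_le (hρ : ∀ᵐ x ∂ρ, x ∈ Set.Icc (-c) c) {m : ℝ} (hm : 0 < m)
    {v : ℝ≥0} (hv : v ≠ 0) :
    (∫ z in Set.Iio (-c), Real.exp (-(2 * m / v) * z) ∂(ρ.conv (gaussianReal m v))) *
        (gaussianReal (-m) v).real (Set.Ioi 0) ≤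
      Real.exp (2 * m / v * c) * (gaussianReal m v).real (Set.Ioi 0) *
        (ρ.conv (gaussianReal m v)).real (Set.Iio (-c)) := by
  have h0 : 0 ≤ 2 * m / (v : ℝ) := by positivity
  have e : ∀ z, Real.exp (2 * m / v * (-c - z)) =
      Real.exp (-(2 * m / v * c)) * Real.exp (-(2 * m / v) * z) := by
    intro z
    rw [← Real.exp_add]
    congr 1
    ring
  have h := setIntegral_Iio_conv_gaussianReal_le hρ m hv
    (f := fun u => Real.exp (2 * m / v * u))
    (fun x _ y _ hxy => Real.exp_le_exp.2 (by nlinarith))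
    (integrable_exp_mul_gaussianReal _)
    (by simp_rw [e]; exact (integrable_exp_mul_conv_gaussianReal hρ m v _).const_mul _)
  simp_rw [e, integral_const_mul] at h
  rw [setIntegral_Ioi_exp_gaussianReal_neg m hv, Real.exp_neg, mul_assoc,
    inv_mul_le_iff₀ (Real.exp_pos _)] at h
  linarith

theorem setIntegral_Ioi_sub_conv_le (hρ : ∀ᵐ x ∂ρ, x ∈ Set.Icc (-c) c) (m : ℝ)
    {v : ℝ≥0} (hv : v ≠ 0) :
    (∫ z in Set.Ioi c, (z - c) ∂(ρ.conv (gaussianReal m v))) *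
        (gaussianReal m v).real (Set.Ioi 0) ≤
      (∫ x in Set.Ioi 0, x ∂(gaussianReal m v)) *
        (ρ.conv (gaussianReal m v)).real (Set.Ioi c) :=
  setIntegral_Ioi_conv_gaussianReal_le (hρ.mono fun _ hx => hx.2) m hv (f := fun u => u)
    (fun _ _ _ _ h => h) (integrable_id_gaussianReal m v)
    ((integrable_id_conv_gaussianReal hρ m v).sub (integrable_const c))

theorem setIntegral_Iio_sub_conv_le (hρ : ∀ᵐ x ∂ρ, x ∈ Set.Icc (-c) c) (m : ℝ)
    {v : ℝ≥0} (hv : v ≠ 0) :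
    (∫ z in Set.Iio (-c), (-c - z) ∂(ρ.conv (gaussianReal m v))) *
        (gaussianReal (-m) v).real (Set.Ioi 0) ≤
      (∫ x in Set.Ioi 0, x ∂(gaussianReal (-m) v)) *
        (ρ.conv (gaussianReal m v)).real (Set.Iio (-c)) :=
  setIntegral_Iio_conv_gaussianReal_le hρ m hv (f := fun u => u)
    (fun _ _ _ _ h => h) (integrable_id_gaussianReal (-m) v)
    ((integrable_const (-c)).sub (integrable_id_conv_gaussianReal hρ m v))

end OneStep

theorem setIntegral_le_const_mul {κ : Measure ℝ} [IsFiniteMeasure κ] {f : ℝ → ℝ}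
    (hf : Integrable f κ) {s : Set ℝ} (hs : MeasurableSet s) {C : ℝ} (h : ∀ z ∈ s, f z ≤ C) :
    ∫ z in s, f z ∂κ ≤ C * κ.real s := by
  have := setIntegral_mono_on hf.integrableOn (integrable_const C).integrableOn hs h
  simpa [mul_comm] using this

theorem setIntegral_lt_const_mul {κ : Measure ℝ} [IsFiniteMeasure κ] {f : ℝ → ℝ}
    (hf : Integrable f κ) {s : Set ℝ} (hs : MeasurableSet s) {C : ℝ} (h : ∀ z ∈ s, f z < C)
    (hκ : 0 < κ.real s) : ∫ z in s, f z ∂κ < C * κ.real s := by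
  have h1 : 0 < ∫ z in s, (C - f z) ∂κ := by
    refine (setIntegral_pos_iff_support_of_nonneg_ae ?_
      ((integrable_const C).sub hf).integrableOn).2 ?_
    · filter_upwards [ae_restrict_mem hs] with z hz using sub_nonneg.2 (h z hz).le
    · have : (Function.support fun z => C - f z) ∩ s = s :=
        Set.inter_eq_right.2 fun z hz => (sub_pos.2 (h z hz)).ne'
      change 0 < κ ((Function.support fun z => C - f z) ∩ s)
      rw [this]
      exact (ENNReal.toReal_pos_iff.1 hκ).1
  rw [integral_sub (integrable_const C) hf.integrableOn] at h1
  simp at h1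
  linarith

/-! ### The walk killed on leaving [-c, c], and its optional stopping identities. -/

/-- The law of the `n`-th partial sum of a random walk with step law `γ`, restricted to the event
that the walk has stayed in `[-c, c]` up to time `n`. -/
noncomputable def killedLaw (γ : Measure ℝ) (c : ℝ) : ℕ → Measure ℝ
  | 0 => Measure.dirac 0
  | n + 1 => ((killedLaw γ c n).conv γ).restrict (Set.Icc (-c) c)

theorem killedLaw_ae_mem_Icc {γ : Measure ℝ} {c : ℝ} (hc : 0 < c) (n : ℕ) :
    ∀ᵐ x ∂(killedLaw γ c n), x ∈ Set.Icc (-c) c := by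
  cases n with
  | zero =>
    rw [killedLaw]
    refine (ae_dirac_iff measurableSet_Icc).2 ?_
    exact ⟨by linarith, hc.le⟩
  | succ n => exact ae_restrict_mem measurableSet_Icc

/-- After one more step the mass leaves above, leaves below, or survives. Taking f = 1, an
exponential, or the identity makes the three sums below telescope. -/
theorem integral_killedLaw_conv {γ : Measure ℝ} {c : ℝ} (hc : 0 < c) (n : ℕ) {f : ℝ → ℝ}
    (hf : Integrable f ((killedLaw γ c n).conv γ)) :
    ∫ z, f z ∂((killedLaw γ c n).conv γ) =
      ∫ z in Set.Ioi c, f z ∂((killedLaw γ c n).conv γ) +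
        ∫ z in Set.Iio (-c), f z ∂((killedLaw γ c n).conv γ) +
        ∫ x, f x ∂(killedLaw γ c (n + 1)) := by
  have h1 : (Set.Icc (-c) c)ᶜ = Set.Ioi c ∪ Set.Iio (-c) := by
    ext z
    simp only [Set.mem_compl_iff, Set.mem_Icc, Set.mem_union, Set.mem_Ioi, Set.mem_Iio,
      not_and_or, not_le]
    exact or_comm
  have h2 : Disjoint (Set.Ioi c) (Set.Iio (-c)) :=
    Set.disjoint_left.2 fun z hz hz' => by
      have h3 : c < z := hz
      have h4 : z < -c := hz'
      linarith
  rw [← setIntegral_union h2 measurableSet_Iio hf.integrableOn hf.integrableOn, ← h1, killedLaw,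
    add_comm, integral_add_compl measurableSet_Icc hf]

section KilledLaw

variable {γ : Measure ℝ} [IsProbabilityMeasure γ] {c : ℝ}

instance isFiniteMeasure_killedLaw (n : ℕ) : IsFiniteMeasure (killedLaw γ c n) := by
  induction n with
  | zero => rw [killedLaw]; infer_instance
  | succ n ih => rw [killedLaw]; infer_instance

theorem measureReal_killedLaw_univ (hc : 0 < c) (n : ℕ) :
    (killedLaw γ c n).real Set.univ = ((killedLaw γ c n).conv γ).real (Set.Ioi c) +
      ((killedLaw γ c n).conv γ).real (Set.Iio (-c)) +
        (killedLaw γ c (n + 1)).real Set.univ := by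
  have h := integral_killedLaw_conv (γ := γ) hc n (f := fun _ => 1) (integrable_const _)
  have h2 : ((killedLaw γ c n).conv γ) Set.univ = killedLaw γ c n Set.univ := by
    rw [Measure.conv, Measure.map_apply (by fun_prop) MeasurableSet.univ, Set.preimage_univ,
      ← Set.univ_prod_univ, Measure.prod_prod, measure_univ (μ := γ), mul_one]
  have h3 : ((killedLaw γ c n).conv γ).real Set.univ = (killedLaw γ c n).real Set.univ :=
    congrArg ENNReal.toReal h2
  simpa [h3] using h

theorem sum_killedLaw_exit (hc : 0 < c) (N : ℕ) :
    ∑ n ∈ Finset.range N, (((killedLaw γ c n).conv γ).real (Set.Ioi c) +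
      ((killedLaw γ c n).conv γ).real (Set.Iio (-c))) =
        1 - (killedLaw γ c N).real Set.univ := by
  induction N with
  | zero => simp [killedLaw]
  | succ N ih =>
    rw [Finset.sum_range_succ, ih, measureReal_killedLaw_univ hc N]
    ring

end KilledLaw

section Gaussian

variable {m : ℝ} {v : ℝ≥0} {c : ℝ}

/-- Optional stopping of the exponential martingale at the minimum of τ and N; the 1 is its value at
the origin. -/
theorem sum_killedLaw_exp (hv : v ≠ 0) (hc : 0 < c) (N : ℕ) :
    ∑ n ∈ Finset.range N,
      (∫ z in Set.Ioi c, Real.exp (-(2 * m / v) * z)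
          ∂((killedLaw (gaussianReal m v) c n).conv (gaussianReal m v)) +
        ∫ z in Set.Iio (-c), Real.exp (-(2 * m / v) * z)
          ∂((killedLaw (gaussianReal m v) c n).conv (gaussianReal m v))) =
      1 - ∫ x, Real.exp (-(2 * m / v) * x) ∂(killedLaw (gaussianReal m v) c N) := by
  induction N with
  | zero => simp [killedLaw]
  | succ N ih =>
    have hρ := killedLaw_ae_mem_Icc (γ := gaussianReal m v) hc N
    have h := integral_killedLaw_conv (γ := gaussianReal m v) hc N
      (integrable_exp_mul_conv_gaussianReal hρ m v (-(2 * m / v)))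
    rw [integral_exp_conv_gaussianReal hρ m hv] at h
    rw [Finset.sum_range_succ, ih, h]
    ring

/-- Wald's identity truncated at N, with each exit position split into the barrier ±c and the excess
beyond it. -/
theorem sum_killedLaw_id (hc : 0 < c) (N : ℕ) :
    ∑ n ∈ Finset.range N,
      (c * (((killedLaw (gaussianReal m v) c n).conv (gaussianReal m v)).real (Set.Ioi c) -
        ((killedLaw (gaussianReal m v) c n).conv (gaussianReal m v)).real (Set.Iio (-c))) +
      (∫ z in Set.Ioi c, (z - c)
          ∂((killedLaw (gaussianReal m v) c n).conv (gaussianReal m v)) -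
        ∫ z in Set.Iio (-c), (-c - z)
          ∂((killedLaw (gaussianReal m v) c n).conv (gaussianReal m v)))) =
      m * ∑ n ∈ Finset.range N, (killedLaw (gaussianReal m v) c n).real Set.univ -
        ∫ x, x ∂(killedLaw (gaussianReal m v) c N) := by
  induction N with
  | zero => simp [killedLaw]
  | succ N ih =>
    have hρ := killedLaw_ae_mem_Icc (γ := gaussianReal m v) hc N
    have hi := integrable_id_conv_gaussianReal hρ m v
    have h := integral_killedLaw_conv (γ := gaussianReal m v) hc N hi
    rw [integral_id_conv_gaussianReal hρ m v] at h
    rw [Finset.sum_range_succ, ih, Finset.sum_range_succ,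
      integral_sub hi.integrableOn (integrable_const c),
      integral_sub (integrable_const (-c)) hi.integrableOn]
    simp only [integral_const, measureReal_restrict_apply_univ, smul_eq_mul]
    linarith

end Gaussian

/-! ### Passage to the limit and the bounds for the killed walk. -/

/-- Real-sequence bookkeeping for the exit of a random walk from an interval: the sequences are the
survival probabilities `a`, the probabilities `p`, `q` of leaving through either side, the
exponential functionals `A`, `B`, the mean excesses `U`, `D`, and remainders `E`, `X`. -/
theorem exit_sums {a p q A B U D E X : ℕ → ℝ} {m c l r k C : ℝ} (hm : 0 < m) (hc : 0 < c)
    (ha : ∀ n, 0 ≤ a n) (hp : ∀ n, 0 ≤ p n) (hq : ∀ n, 0 ≤ q n)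
    (hA : ∀ n, 0 ≤ A n) (hB : ∀ n, 0 ≤ B n) (hU : ∀ n, 0 ≤ U n) (hD : ∀ n, 0 ≤ D n)
    (hUC : ∀ n, U n ≤ C * p n) (hDC : ∀ n, D n ≤ C * q n) (hC : 0 ≤ C)
    (hE : ∀ n, |E n| ≤ k * a n) (hX : ∀ n, |X n| ≤ c * a n)
    (hpA : ∀ n, A n ≤ l * p n) (hqB : ∀ n, B n ≤ r * q n)
    (spq : ∀ N, ∑ n ∈ Finset.range N, (p n + q n) = 1 - a N)
    (sAB : ∀ N, ∑ n ∈ Finset.range N, (A n + B n) = 1 - E N)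
    (sUD : ∀ N, ∑ n ∈ Finset.range N, (c * (p n - q n) + (U n - D n)) =
      m * ∑ n ∈ Finset.range N, a n - X N) :
    Summable a ∧ Summable p ∧ Summable q ∧ Summable A ∧ Summable B ∧
      ∑' n, p n + ∑' n, q n = 1 ∧ ∑' n, A n + ∑' n, B n = 1 ∧
      |m * ∑' n, a n - c * (∑' n, p n - ∑' n, q n)| ≤ C := by
  have hpq : Summable fun n => p n + q n :=
    summable_of_sum_range_le (c := 1) (fun n => add_nonneg (hp n) (hq n))
      (fun N => by rw [spq N]; linarith [ha N])
  have sp : Summable p := hpq.of_nonneg_of_le hp fun n => le_add_of_nonneg_right (hq n)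
  have sq : Summable q := hpq.of_nonneg_of_le hq fun n => le_add_of_nonneg_left (hp n)
  have sA : Summable A := (sp.mul_left l).of_nonneg_of_le hA hpA
  have sB : Summable B := (sq.mul_left r).of_nonneg_of_le hB hqB
  have sU : Summable U := (sp.mul_left C).of_nonneg_of_le hU hUC
  have sD : Summable D := (sq.mul_left C).of_nonneg_of_le hD hDC
  have ha1 : ∀ N, a N ≤ 1 := fun N => by
    have : 0 ≤ ∑ n ∈ Finset.range N, (p n + q n) :=
      Finset.sum_nonneg fun n _ => add_nonneg (hp n) (hq n)
    rw [spq N] at this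
    linarith
  -- Wald's identity alone bounds the partial sums, as position and excess are controlled. Only
  -- afterwards does a → 0 follow, which kills the remainders and gives almost sure exit.
  have hsa : Summable a := by
    refine summable_of_sum_range_le (c := (c + C + c) / m) ha fun N => ?_
    rw [le_div_iff₀ hm]
    have h1 : ∑ n ∈ Finset.range N, (c * (p n - q n) + (U n - D n)) ≤
        ∑ n ∈ Finset.range N, (c + C) * (p n + q n) := by
      refine Finset.sum_le_sum fun n _ => ?_
      nlinarith [hUC n, hD n, mul_nonneg hc.le (hq n), mul_nonneg hC (hq n)]
    rw [← Finset.mul_sum, spq N, sUD N] at h1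
    have h2 := (abs_le.1 (hX N)).2
    nlinarith [ha N, ha1 N, mul_nonneg hc.le (ha N), mul_nonneg hC (ha N)]
  have ta := hsa.tendsto_atTop_zero
  have tE : Filter.Tendsto E Filter.atTop (nhds 0) :=
    squeeze_zero_norm hE (by simpa using ta.const_mul k)
  have tX : Filter.Tendsto X Filter.atTop (nhds 0) :=
    squeeze_zero_norm hX (by simpa using ta.const_mul c)
  have e1 : ∑' n, p n + ∑' n, q n = 1 := by
    rw [← sp.tsum_add sq]
    refine tendsto_nhds_unique hpq.hasSum.tendsto_sum_nat ?_
    simp_rw [spq]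
    simpa using ta.const_sub 1
  have e2 : ∑' n, A n + ∑' n, B n = 1 := by
    rw [← sA.tsum_add sB]
    refine tendsto_nhds_unique (sA.add sB).hasSum.tendsto_sum_nat ?_
    simp_rw [sAB]
    simpa using tE.const_sub 1
  have e3 : c * (∑' n, p n - ∑' n, q n) + (∑' n, U n - ∑' n, D n) = m * ∑' n, a n := by
    rw [← sp.tsum_sub sq, ← sU.tsum_sub sD, ← tsum_mul_left,
      ← ((sp.sub sq).mul_left c).tsum_add (sU.sub sD)]
    refine tendsto_nhds_unique
      (((sp.sub sq).mul_left c).add (sU.sub sD)).hasSum.tendsto_sum_nat ?_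
    simp_rw [sUD]
    simpa using (hsa.hasSum.tendsto_sum_nat.const_mul m).sub tX
  refine ⟨hsa, sp, sq, sA, sB, e1, e2, ?_⟩
  have u1 : ∑' n, U n ≤ C * ∑' n, p n := by
    rw [← tsum_mul_left]
    exact sU.tsum_le_tsum hUC (sp.mul_left C)
  have d1 : ∑' n, D n ≤ C * ∑' n, q n := by
    rw [← tsum_mul_left]
    exact sD.tsum_le_tsum hDC (sq.mul_left C)
  have u0 : 0 ≤ ∑' n, U n := tsum_nonneg hU
  have d0 : 0 ≤ ∑' n, D n := tsum_nonneg hD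
  have p0 : 0 ≤ C * ∑' n, p n := mul_nonneg hC (tsum_nonneg hp)
  have q0 : 0 ≤ C * ∑' n, q n := mul_nonneg hC (tsum_nonneg hq)
  have s0 : C * ∑' n, p n + C * ∑' n, q n = C := by rw [← mul_add, e1, mul_one]
  rw [abs_le]
  constructor <;> linarith

theorem measureReal_Ioi_gaussianReal_pos (m : ℝ) {v : ℝ≥0} (hv : v ≠ 0) (a : ℝ) :
    0 < (gaussianReal m v).real (Set.Ioi a) := by
  refine ENNReal.toReal_pos (fun h => ?_) (measure_ne_top _ _)
  have := gaussianReal_absolutelyContinuous' m hv h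
  simp at this

theorem measureReal_Ioi_gaussianReal_neg_le {m : ℝ} (hm : 0 < m) {v : ℝ≥0} (hv : v ≠ 0) :
    (gaussianReal (-m) v).real (Set.Ioi 0) ≤ (gaussianReal m v).real (Set.Ioi 0) := by
  rw [← setIntegral_Ioi_exp_gaussianReal m hv]
  have h0 : 0 ≤ 2 * m / (v : ℝ) := by positivity
  have := setIntegral_le_const_mul (κ := gaussianReal m v) (s := Set.Ioi 0) (C := 1)
    (integrable_exp_mul_gaussianReal (-(2 * m / v))) measurableSet_Ioi fun z hz =>
      Real.exp_le_one_iff.2 (by nlinarith [mul_nonneg h0 (le_of_lt (show (0 : ℝ) < z from hz))])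
  simpa using this

/-- A constant bounding the conditional mean excess over either barrier. -/
noncomputable def excessBound (m : ℝ) (v : ℝ≥0) : ℝ :=
  (∫ x in Set.Ioi 0, x ∂(gaussianReal m v)) / (gaussianReal m v).real (Set.Ioi 0) +
    (∫ x in Set.Ioi 0, x ∂(gaussianReal (-m) v)) / (gaussianReal (-m) v).real (Set.Ioi 0)

theorem exit_probability_bounds {P Q A B G H e : ℝ} (he : 1 < e) (hH : 0 < H) (hHG : H ≤ G)
    (hP : 0 ≤ P) (hQ : 0 ≤ Q) (hPQ : P + Q = 1) (hAB : A + B = 1)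
    (hA1 : e⁻¹ * H * P ≤ A * G) (hA2 : A ≤ e⁻¹ * P) (hA3 : 0 < P → A < e⁻¹ * P)
    (hB1 : B * H ≤ e * G * Q) (hB2 : e * Q ≤ B) (hB3 : 0 < Q → e * Q < B) :
    (e - 1) / (e - H / G * e⁻¹) < P ∧ P < (e * (G / H) - 1) / (e * (G / H) - e⁻¹) ∧
      Q ≤ e⁻¹ := by
  have hG : 0 < G := hH.trans_le hHG
  have he0 : 0 < e := by linarith
  have hi0 : 0 < e⁻¹ := by positivity
  have hi1 : e⁻¹ < 1 := inv_lt_one_of_one_lt₀ he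
  have hr1 : H / G ≤ 1 := (div_le_one hG).2 hHG
  have hR1 : 1 ≤ G / H := (one_le_div hH).2 hHG
  have hA1' : H / G * e⁻¹ * P ≤ A := by
    rw [div_mul_eq_mul_div, div_mul_eq_mul_div, div_le_iff₀ hG]
    linarith
  have hB1' : B ≤ e * (G / H) * Q := by
    rw [mul_div_assoc', div_mul_eq_mul_div, le_div_iff₀ hH]
    exact hB1
  -- Both sides must be reached with positive probability for the strict bounds: P = 0 would force B
  -- ≥ e > 1, and Q = 0 would force A ≤ 1/e < 1.
  have hP0 : 0 < P := by
    refine lt_of_le_of_ne hP fun h => ?_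
    subst h
    have : Q = 1 := by linarith
    subst this
    linarith
  have hQ0 : 0 < Q := by
    refine lt_of_le_of_ne hQ fun h => ?_
    subst h
    have : P = 1 := by linarith
    subst this
    linarith
  have hA : A < e⁻¹ * P := hA3 hP0
  have hB : e * Q < B := hB3 hQ0
  have hQe : Q = 1 - P := by linarith
  subst hQe
  refine ⟨?_, ?_, ?_⟩
  · rw [div_lt_iff₀ (by nlinarith)]
    nlinarith
  · rw [lt_div_iff₀ (by nlinarith)]
    nlinarith
  · rw [← one_div, le_div_iff₀ he0]
    have : 0 ≤ H / G * e⁻¹ * P := by positivity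
    linarith

theorem exists_pos_of_tsum_pos {p : ℕ → ℝ} (h0 : ∀ n, 0 ≤ p n) (h : 0 < ∑' n, p n) :
    ∃ n, 0 < p n := by
  by_contra! h'
  have : p = 0 := funext fun n => le_antisymm (h' n) (h0 n)
  simp [this] at h

theorem killedLaw_exit {m : ℝ} (hm : 0 < m) {v : ℝ≥0} (hv : v ≠ 0) {c : ℝ} (hc : 0 < c) :
    Summable (fun n => (killedLaw (gaussianReal m v) c n).real Set.univ) ∧
    ∃ P, P = ∑' n,
      ((killedLaw (gaussianReal m v) c n).conv (gaussianReal m v)).real (Set.Ioi c) ∧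
    (Real.exp (2 * m / v * c) - 1) / (Real.exp (2 * m / v * c) -
      (gaussianReal (-m) v).real (Set.Ioi 0) / (gaussianReal m v).real (Set.Ioi 0) *
        (Real.exp (2 * m / v * c))⁻¹) < P ∧
    P < (Real.exp (2 * m / v * c) *
        ((gaussianReal m v).real (Set.Ioi 0) / (gaussianReal (-m) v).real (Set.Ioi 0)) - 1) /
      (Real.exp (2 * m / v * c) *
        ((gaussianReal m v).real (Set.Ioi 0) / (gaussianReal (-m) v).real (Set.Ioi 0)) -
        (Real.exp (2 * m / v * c))⁻¹) ∧
    P ≤ 1 ∧ 1 - P ≤ (Real.exp (2 * m / v * c))⁻¹ ∧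
    |m * ∑' n, (killedLaw (gaussianReal m v) c n).real Set.univ - c * (2 * P - 1)| ≤
      excessBound m v := by
  set γ := gaussianReal m v with hγ
  set G := γ.real (Set.Ioi 0) with hGdef
  set H := (gaussianReal (-m) v).real (Set.Ioi 0) with hHdef
  set e := Real.exp (2 * m / v * c) with hedef
  have hv' : (0 : ℝ) < v := by exact_mod_cast pos_iff_ne_zero.2 hv
  have hΛ : 0 < 2 * m / (v : ℝ) := by positivity
  have he : 1 < e := Real.one_lt_exp_iff.2 (by positivity)
  have hei : Real.exp (-(2 * m / v) * c) = e⁻¹ := by rw [hedef, ← Real.exp_neg, neg_mul]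
  have hei' : Real.exp (-(2 * m / v * c)) = e⁻¹ := by rw [hedef, ← Real.exp_neg]
  have hee : Real.exp (-(2 * m / v) * -c) = e := by rw [hedef, neg_mul_neg]
  have hG : 0 < G := measureReal_Ioi_gaussianReal_pos m hv 0
  have hH : 0 < H := measureReal_Ioi_gaussianReal_pos (-m) hv 0
  have hHG : H ≤ G := measureReal_Ioi_gaussianReal_neg_le hm hv
  let ρ := killedLaw γ c
  let κ : ℕ → Measure ℝ := fun n => (ρ n).conv γ
  have hρ : ∀ n, ∀ᵐ x ∂(ρ n), x ∈ Set.Icc (-c) c := killedLaw_ae_mem_Icc hc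
  have hexp : ∀ n, Integrable (fun z => Real.exp (-(2 * m / v) * z)) (κ n) :=
    fun n => integrable_exp_mul_conv_gaussianReal (hρ n) m v _
  let a := fun n => (ρ n).real Set.univ
  let p := fun n => (κ n).real (Set.Ioi c)
  let q := fun n => (κ n).real (Set.Iio (-c))
  let A := fun n => ∫ z in Set.Ioi c, Real.exp (-(2 * m / v) * z) ∂(κ n)
  let B := fun n => ∫ z in Set.Iio (-c), Real.exp (-(2 * m / v) * z) ∂(κ n)
  let U := fun n => ∫ z in Set.Ioi c, (z - c) ∂(κ n)
  let D := fun n => ∫ z in Set.Iio (-c), (-c - z) ∂(κ n)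
  have hM1 : 0 ≤ (∫ x in Set.Ioi 0, x ∂γ) / G :=
    div_nonneg (setIntegral_nonneg measurableSet_Ioi fun x hx => le_of_lt hx) hG.le
  have hM2 : 0 ≤ (∫ x in Set.Ioi 0, x ∂(gaussianReal (-m) v)) / H :=
    div_nonneg (setIntegral_nonneg measurableSet_Ioi fun x hx => le_of_lt hx) hH.le
  have hp : ∀ n, 0 ≤ p n := fun n => measureReal_nonneg
  have hq : ∀ n, 0 ≤ q n := fun n => measureReal_nonneg
  have hA2 : ∀ n, A n ≤ e⁻¹ * p n := fun n => by
    rw [← hei]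
    refine setIntegral_le_const_mul (hexp n) measurableSet_Ioi fun z hz => ?_
    have hz' : c < z := hz
    exact Real.exp_le_exp.2 (by nlinarith)
  have hA3 : ∀ n, 0 < p n → A n < e⁻¹ * p n := fun n hn => by
    rw [← hei]
    refine setIntegral_lt_const_mul (hexp n) measurableSet_Ioi (fun z hz => ?_) hn
    have hz' : c < z := hz
    exact Real.exp_lt_exp.2 (by nlinarith)
  have hB2 : ∀ n, e * q n ≤ B n := fun n => by
    have := setIntegral_le_const_mul (hexp n).neg (measurableSet_Iio (a := -c)) (C := -e)
      fun z hz => by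
        have hz' : z < -c := hz
        rw [← hee]
        exact neg_le_neg (Real.exp_le_exp.2 (by nlinarith))
    simp only [Pi.neg_apply, integral_neg] at this
    linarith
  have hB3 : ∀ n, 0 < q n → e * q n < B n := fun n hn => by
    have := setIntegral_lt_const_mul (hexp n).neg (measurableSet_Iio (a := -c)) (C := -e)
      (fun z hz => by
        have hz' : z < -c := hz
        rw [← hee]
        exact neg_lt_neg (Real.exp_lt_exp.2 (by nlinarith))) hn
    simp only [Pi.neg_apply, integral_neg] at this
    linarith
  have hA1 : ∀ n, e⁻¹ * H * p n ≤ A n * G := fun n => by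
    rw [← hei']
    exact le_setIntegral_Ioi_exp_conv (hρ n) hm hv
  have hB1 : ∀ n, B n * H ≤ e * G * q n := fun n => setIntegral_Iio_exp_conv_le (hρ n) hm hv
  have hbound : ∀ (f : ℝ → ℝ) (C : ℝ), (∀ x ∈ Set.Icc (-c) c, |f x| ≤ C) →
      ∀ n, |∫ x, f x ∂(ρ n)| ≤ C * a n := fun f C hf n => by
    rw [← Real.norm_eq_abs]
    exact norm_integral_le_of_norm_le_const ((hρ n).mono hf)
  have hE := hbound (fun x => Real.exp (-(2 * m / v) * x)) e fun x hx => by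
    rw [Real.abs_exp, ← hee]
    exact Real.exp_le_exp.2 (by nlinarith [hx.1])
  have hX := hbound (fun x => x) c fun x hx => abs_le.2 hx
  obtain ⟨s1, s2, s3, s4, s5, e1, e2, e3⟩ := exit_sums (a := a) (p := p) (q := q) (A := A)
    (B := B) (U := U) (D := D) (E := fun n => ∫ x, Real.exp (-(2 * m / v) * x) ∂(ρ n))
    (X := fun n => ∫ x, x ∂(ρ n)) (l := e⁻¹) (r := e * G / H) (k := e) (C := excessBound m v)
    hm hc
    (fun n => measureReal_nonneg) hp hq
    (fun n => integral_nonneg fun z => (Real.exp_pos _).le)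
    (fun n => integral_nonneg fun z => (Real.exp_pos _).le)
    (fun n => setIntegral_nonneg measurableSet_Ioi fun x hx => sub_nonneg.2 (le_of_lt hx))
    (fun n => setIntegral_nonneg measurableSet_Iio fun x hx => sub_nonneg.2 (le_of_lt hx))
    (fun n => by
      have h := (le_div_iff₀ hG).2 (setIntegral_Ioi_sub_conv_le (hρ n) m hv)
      rw [mul_div_right_comm] at h
      exact h.trans (mul_le_mul_of_nonneg_right (le_add_of_nonneg_right hM2) (hp n)))
    (fun n => by
      have h := (le_div_iff₀ hH).2 (setIntegral_Iio_sub_conv_le (hρ n) m hv)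
      rw [mul_div_right_comm] at h
      exact h.trans (mul_le_mul_of_nonneg_right (le_add_of_nonneg_left hM1) (hq n)))
    (add_nonneg hM1 hM2) hE hX hA2
    (fun n => by
      rw [div_mul_eq_mul_div, le_div_iff₀ hH]
      exact hB1 n)
    (sum_killedLaw_exit hc) (sum_killedLaw_exp hv hc) (sum_killedLaw_id hc)
  have hP0 : 0 ≤ ∑' n, p n := tsum_nonneg hp
  have hQ0 : 0 ≤ ∑' n, q n := tsum_nonneg hq
  obtain ⟨f1, f2, f3⟩ := exit_probability_bounds he hH hHG hP0 hQ0 e1 e2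
    (by
      rw [← tsum_mul_left, ← tsum_mul_right]
      exact (s2.mul_left _).tsum_le_tsum hA1 (s4.mul_right _))
    (by
      rw [← tsum_mul_left]
      exact s4.tsum_le_tsum hA2 (s2.mul_left _))
    -- A single time with positive exit probability makes the termwise inequality, hence the sum,
    -- strict.
    (fun h => by
      obtain ⟨n, hn⟩ := exists_pos_of_tsum_pos hp h
      rw [← tsum_mul_left]
      exact s4.tsum_lt_tsum hA2 (hA3 n hn) (s2.mul_left _))
    (by
      rw [← tsum_mul_left, ← tsum_mul_right]
      exact (s5.mul_right _).tsum_le_tsum hB1 (s3.mul_left _))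
    (by
      rw [← tsum_mul_left]
      exact (s3.mul_left _).tsum_le_tsum hB2 s5)
    (fun h => by
      obtain ⟨n, hn⟩ := exists_pos_of_tsum_pos hq h
      rw [← tsum_mul_left]
      exact (s3.mul_left _).tsum_lt_tsum hB2 (hB3 n hn) s5)
  refine ⟨s1, ∑' n, p n, rfl, f1, f2, by linarith, by linarith, ?_⟩
  have : c * (2 * ∑' n, p n - 1) = c * (∑' n, p n - ∑' n, q n) := by rw [← e1]; ring
  rw [this]
  exact e3

/-! ### Transfer from the killed law to the exit time. -/

section Walk

variable {Ω : Type*} {V : ℕ → Ω → ℝ} {c : ℝ}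

theorem partialSum_succ (V : ℕ → Ω → ℝ) (n : ℕ) (ω : Ω) :
    partialSum V (n + 1) ω = partialSum V n ω + V n ω :=
  Finset.sum_range_succ _ _

/-- The event that the walk has stayed in `[-c, c]` up to time `n`. -/
def survival (V : ℕ → Ω → ℝ) (c : ℝ) (n : ℕ) : Set Ω :=
  {ω | ∀ k, 1 ≤ k → k ≤ n → partialSum V k ω ∈ Set.Icc (-c) c}

theorem survival_zero : survival V c 0 = Set.univ :=
  Set.eq_univ_of_forall fun ω k h1 h2 => by omega

theorem survival_succ (n : ℕ) :
    survival V c (n + 1) = survival V c n ∩ partialSum V (n + 1) ⁻¹' Set.Icc (-c) c := by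
  ext ω
  constructor
  · exact fun h => ⟨fun k h1 h2 => h k h1 (by omega), h (n + 1) (by omega) le_rfl⟩
  · rintro ⟨h1, h2⟩ k hk1 hk2
    rcases Nat.lt_or_ge n k with h | h
    · obtain rfl : k = n + 1 := by omega
      exact h2
    · exact h1 k hk1 h

/-- Replaces the hitting time by events that depend on finitely many steps. At n = 0 both sides
always hold, because the hitting time starts counting at 1. -/
theorem lt_exitTime_iff (n : ℕ) (ω : Ω) : (n : ℕ∞) < exitTime V c ω ↔ ω ∈ survival V c n := by
  constructor
  · intro h k h1 h2
    have hk : (k : ℕ∞) < exitTime V c ω := lt_of_le_of_lt (by exact_mod_cast h2) h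
    have h3 : ¬(partialSum V k ω < -c ∨ c < partialSum V k ω) :=
      notMem_of_lt_hittingAfter (ι := ℕ) hk h1
    push Not at h3
    exact h3
  · intro h
    by_contra! h'
    have hne : exitTime V c ω ≠ ⊤ := fun h4 => by simp [h4] at h'
    have hex : ∃ j, 1 ≤ j ∧ partialSum V j ω ∈ {x : ℝ | x < -c ∨ c < x} := by
      by_contra! h5
      exact hne (hittingAfter_eq_top_iff.2 h5)
    have hmem := hittingAfter_mem_set hex
    obtain ⟨k, hk⟩ := ENat.ne_top_iff_exists.1 hne
    have hk' : hittingAfter (partialSum V) {x : ℝ | x < -c ∨ c < x} 1 ω = ((k : ℕ) : WithTop ℕ) :=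
      hk.symm
    have h1 : ((1 : ℕ) : WithTop ℕ) ≤ hittingAfter (partialSum V) {x : ℝ | x < -c ∨ c < x} 1 ω :=
      le_hittingAfter ω
    rw [hk'] at hmem h1
    rw [← hk] at h'
    have h1' : 1 ≤ k := by exact_mod_cast h1
    have h2' : k ≤ n := by exact_mod_cast h'
    have h6 := h k h1' h2'
    change partialSum V k ω < -c ∨ c < partialSum V k ω at hmem
    rcases hmem with h7 | h7
    · exact absurd h6.1 (not_le.2 h7)
    · exact absurd h6.2 (not_le.2 h7)

theorem exitTime_eq_succ_iff (n : ℕ) (ω : Ω) : exitTime V c ω = ((n + 1 : ℕ) : ℕ∞) ↔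
    ω ∈ survival V c n ∧ ω ∉ survival V c (n + 1) := by
  rw [← lt_exitTime_iff, ← lt_exitTime_iff, not_lt]
  constructor
  · intro h
    rw [h]
    exact ⟨by exact_mod_cast Nat.lt_succ_self n, le_rfl⟩
  · rintro ⟨h1, h2⟩
    refine le_antisymm h2 ?_
    push_cast
    exact Order.add_one_le_of_lt h1

theorem upperExit_eq_iUnion : upperExit V c =
    ⋃ n, (survival V c n ∩ partialSum V (n + 1) ⁻¹' Set.Ioi c) := by
  -- The default value of `WithTop.untopA` at `⊤` plays no role, since the exit time is finite here.
  have hst : ∀ ω n, exitTime V c ω = ((n + 1 : ℕ) : ℕ∞) →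
      stoppedValue (partialSum V) (exitTime V c) ω = partialSum V (n + 1) ω := by
    intro ω n h
    have h' : (exitTime V c ω : WithTop ℕ) = ((n + 1 : ℕ) : WithTop ℕ) := h
    change partialSum V (WithTop.untopA (exitTime V c ω : WithTop ℕ)) ω = _
    rw [h']
    rfl
  ext ω
  simp only [Set.mem_iUnion]
  constructor
  · rintro ⟨h1, h2⟩
    obtain ⟨k, hk⟩ := ENat.ne_top_iff_exists.1 h1
    have h3 : (0 : ℕ) < exitTime V c ω := (lt_exitTime_iff 0 ω).2 (by simp [survival_zero])
    rw [← hk] at h3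
    have h4 : 0 < k := by exact_mod_cast h3
    obtain ⟨n, rfl⟩ : ∃ n, k = n + 1 := ⟨k - 1, by omega⟩
    rw [hst ω n hk.symm] at h2
    exact ⟨n, ((exitTime_eq_succ_iff n ω).1 hk.symm).1, h2⟩
  · rintro ⟨n, h1, h2⟩
    have h3 : exitTime V c ω = ((n + 1 : ℕ) : ℕ∞) := by
      refine (exitTime_eq_succ_iff n ω).2 ⟨h1, fun h => ?_⟩
      exact absurd (h (n + 1) (by omega) le_rfl).2 (not_le.2 h2)
    refine ⟨by rw [h3]; exact ENat.natCast_ne_top _, ?_⟩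
    rw [hst ω n h3]
    exact h2

theorem pairwise_disjoint_survival_inter :
    Pairwise (Function.onFun Disjoint
      fun n => survival V c n ∩ partialSum V (n + 1) ⁻¹' Set.Ioi c) := by
  refine (pairwise_disjoint_on _).2 fun i j hij => Set.disjoint_left.2 ?_
  rintro ω ⟨_, h1⟩ ⟨h2, _⟩
  exact absurd (h2 (i + 1) (by omega) hij).2 (not_le.2 h1)

/-- Exactly τ natural numbers n satisfy n < τ, also when τ is infinite; integration gives the
tail-sum formula for E[τ]. -/
theorem tsum_indicator_survival (ω : Ω) :
    ∑' n, (survival V c n).indicator (fun _ => (1 : ℝ≥0∞)) ω = (exitTime V c ω : ℝ≥0∞) := by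
  have e : ∀ n : ℕ, (survival V c n).indicator (fun _ => (1 : ℝ≥0∞)) ω =
      {n : ℕ | (n : ℕ∞) < exitTime V c ω}.indicator (fun _ => 1) n := by
    intro n
    classical
    simp only [Set.indicator_apply, Set.mem_ofPred_eq, lt_exitTime_iff]
  simp_rw [e]
  rw [← tsum_subtype, ENNReal.tsum_set_one]
  congr 1
  induction exitTime V c ω using ENat.recTopCoe with
  | top => simp
  | coe k =>
    have : {n : ℕ | (n : ℕ∞) < (k : ℕ∞)} = Finset.range k := by
      ext n
      simp
    rw [this, Set.encard_coe_eq_coe_finsetCard, Finset.card_range]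

variable [MeasurableSpace Ω]

theorem measurableSet_survival (hV : ∀ i, Measurable (V i)) (n : ℕ) :
    MeasurableSet (survival V c n) := by
  induction n with
  | zero => simp [survival_zero]
  | succ n ih =>
    rw [survival_succ]
    exact ih.inter ((Finset.measurable_sum _ fun i _ => hV i) measurableSet_Icc)

theorem expectedExitTime_eq_tsum (hV : ∀ i, Measurable (V i)) (P : Measure Ω) :
    expectedExitTime P V c = ∑' n, P (survival V c n) := by
  simp_rw [expectedExitTime, ← tsum_indicator_survival]
  rw [lintegral_tsum fun n => (measurable_const.indicator (measurableSet_survival hV n)).aemeasurable]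
  simp [lintegral_indicator, measurableSet_survival hV]

theorem exitTime_ne_top_ae (hV : ∀ i, Measurable (V i)) {P : Measure Ω}
    (h : expectedExitTime P V c ≠ ⊤) : ∀ᵐ ω ∂P, exitTime V c ω ≠ ⊤ := by
  have hm : Measurable fun ω => (exitTime V c ω : ℝ≥0∞) := by
    simp_rw [← tsum_indicator_survival]
    exact Measurable.tsum fun n => measurable_const.indicator (measurableSet_survival hV n)
  filter_upwards [ae_lt_top hm h] with ω hω
  simpa using hω.ne

/-- Survival to time n and the n-th sum depend only on the steps of index below n, which are
independent of `V n`. -/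
theorem measure_survival_inter_eq_mul {P : Measure Ω} (hV : ∀ i, Measurable (V i))
    (hind : iIndepFun V P) (n : ℕ) {s t : Set ℝ} (hs : MeasurableSet s) (ht : MeasurableSet t) :
    P (survival V c n ∩ partialSum V n ⁻¹' s ∩ V n ⁻¹' t) =
      P (survival V c n ∩ partialSum V n ⁻¹' s) * P (V n ⁻¹' t) := by
  have h := indep_iSup_of_disjoint (fun i => (hV i).comap_le) hind.iIndep
    (S := {i | i < n}) (T := {n}) (by simp)
  rw [Indep_iff] at h
  have hVm : ∀ i < n, Measurable[⨆ i ∈ {i | i < n},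
      MeasurableSpace.comap (V i) inferInstance] (V i) := fun i hi =>
    (comap_measurable (V i)).mono (le_iSup₂_of_le i hi le_rfl) le_rfl
  have hS : ∀ k ≤ n, Measurable[⨆ i ∈ {i | i < n},
      MeasurableSpace.comap (V i) inferInstance] (partialSum V k) := fun k hk =>
    Finset.measurable_sum _ fun i hi => hVm i ((Finset.mem_range.1 hi).trans_le hk)
  refine h _ _ ?_ ?_
  · refine MeasurableSet.inter ?_ (hS n le_rfl hs)
    have : survival V c n = ⋂ k, ⋂ (_ : 1 ≤ k), ⋂ (_ : k ≤ n),
        partialSum V k ⁻¹' Set.Icc (-c) c := by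
      ext ω
      simp [survival]
    rw [this]
    exact MeasurableSet.iInter fun k => MeasurableSet.iInter fun _ => MeasurableSet.iInter
      fun hk => hS k hk measurableSet_Icc
  · have hVn : Measurable[⨆ i ∈ ({n} : Set ℕ), MeasurableSpace.comap (V i) inferInstance] (V n) :=
      (comap_measurable (V n)).mono (le_iSup₂_of_le n rfl le_rfl) le_rfl
    exact hVn ht

variable {P : Measure Ω} [IsProbabilityMeasure P] {γ : Measure ℝ} [IsProbabilityMeasure γ]

theorem map_partialSum_succ (hV : ∀ i, Measurable (V i)) (hind : iIndepFun V P)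
    (hγ : ∀ i, P.map (V i) = γ) (n : ℕ) :
    (P.restrict (survival V c n)).map (partialSum V (n + 1)) =
      ((P.restrict (survival V c n)).map (partialSum V n)).conv γ := by
  have hS : Measurable (partialSum V n) := Finset.measurable_sum _ fun i _ => hV i
  have hprod : ((P.restrict (survival V c n)).map (partialSum V n)).prod γ =
      (P.restrict (survival V c n)).map fun ω => (partialSum V n ω, V n ω) := by
    refine Measure.prod_eq fun s t hs ht => ?_
    rw [Measure.map_apply (hS.prodMk (hV n)) (hs.prod ht), Measure.map_apply hS hs, ← hγ n,
      Measure.map_apply (hV n) ht, Measure.restrict_apply (hS hs),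
      Measure.restrict_apply ((hS.prodMk (hV n)) (hs.prod ht)), Set.mk_preimage_prod,
      Set.inter_comm _ (survival V c n), ← Set.inter_assoc,
      measure_survival_inter_eq_mul hV hind n hs ht, Set.inter_comm (survival V c n)]
  rw [Measure.conv, hprod, Measure.map_map (by fun_prop) (hS.prodMk (hV n))]
  congr 1 with ω
  exact partialSum_succ V n ω

theorem map_partialSum_eq_killedLaw (hV : ∀ i, Measurable (V i)) (hind : iIndepFun V P)
    (hγ : ∀ i, P.map (V i) = γ) (n : ℕ) :
    (P.restrict (survival V c n)).map (partialSum V n) = killedLaw γ c n := by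
  induction n with
  | zero =>
    have : partialSum V 0 = fun _ => 0 := by
      ext ω
      simp [partialSum]
    rw [survival_zero, Measure.restrict_univ, this, Measure.map_const, measure_univ, one_smul,
      killedLaw]
  | succ n ih =>
    have hS : Measurable (partialSum V (n + 1)) := Finset.measurable_sum _ fun i _ => hV i
    rw [survival_succ, Set.inter_comm, ← Measure.restrict_restrict (hS measurableSet_Icc),
      ← Measure.restrict_map hS measurableSet_Icc, map_partialSum_succ hV hind hγ, ih, killedLaw]

theorem measure_survival (hV : ∀ i, Measurable (V i)) (hind : iIndepFun V P)
    (hγ : ∀ i, P.map (V i) = γ) (n : ℕ) :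
    P (survival V c n) = killedLaw γ c n Set.univ := by
  have hS : Measurable (partialSum V n) := Finset.measurable_sum _ fun i _ => hV i
  rw [← map_partialSum_eq_killedLaw hV hind hγ, Measure.map_apply hS MeasurableSet.univ]
  simp

theorem measure_survival_inter_Ioi (hV : ∀ i, Measurable (V i)) (hind : iIndepFun V P)
    (hγ : ∀ i, P.map (V i) = γ) (n : ℕ) :
    P (survival V c n ∩ partialSum V (n + 1) ⁻¹' Set.Ioi c) =
      ((killedLaw γ c n).conv γ) (Set.Ioi c) := by
  have hS : Measurable (partialSum V (n + 1)) := Finset.measurable_sum _ fun i _ => hV i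
  rw [← map_partialSum_eq_killedLaw hV hind hγ, ← map_partialSum_succ hV hind hγ,
    Measure.map_apply hS measurableSet_Ioi, Measure.restrict_apply (hS measurableSet_Ioi),
    Set.inter_comm]

theorem measureReal_upperExit (hV : ∀ i, Measurable (V i)) (hind : iIndepFun V P)
    (hγ : ∀ i, P.map (V i) = γ) :
    P.real (upperExit V c) = ∑' n, ((killedLaw γ c n).conv γ).real (Set.Ioi c) := by
  rw [upperExit_eq_iUnion, Measure.real, measure_iUnion pairwise_disjoint_survival_inter
    fun n => (measurableSet_survival hV n).inter
      ((Finset.measurable_sum _ fun i _ => hV i) measurableSet_Ioi)]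
  simp_rw [measure_survival_inter_Ioi hV hind hγ]
  exact ENNReal.tsum_toReal_eq fun n => measure_ne_top _ _

theorem expectedExitTime_eq_ofReal (hV : ∀ i, Measurable (V i)) (hind : iIndepFun V P)
    (hγ : ∀ i, P.map (V i) = γ)
    (hs : Summable fun n => (killedLaw γ c n).real Set.univ) :
    expectedExitTime P V c = ENNReal.ofReal (∑' n, (killedLaw γ c n).real Set.univ) := by
  rw [expectedExitTime_eq_tsum hV, ENNReal.ofReal_tsum_of_nonneg (fun n => measureReal_nonneg) hs]
  refine tsum_congr fun n => ?_
  rw [measure_survival hV hind hγ, Measure.real, ENNReal.ofReal_toReal (measure_ne_top _ _)]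

end Walk

/-! ### Normal odds, the approximation of E[τ], and the conclusion. -/

theorem one_sub_stdNormalCdf_div {s : ℝ} (hs : 0 < s) (m : ℝ) {v : ℝ≥0} (hv : (v : ℝ) = s ^ 2) :
    1 - stdNormalCdf (m / s) = (gaussianReal (-m) v).real (Set.Ioi 0) := by
  have h : gaussianReal (-m) v = (gaussianReal 0 1).map fun x => -m + s * x := by
    have h1 := gaussianReal_map_const_mul (μ := 0) (v := 1) s
    have h2 := gaussianReal_map_const_add (μ := s * 0) (v := .mk (s ^ 2) (sq_nonneg s) * 1) (-m)
    rw [← h1, Measure.map_map (by fun_prop) (by fun_prop)] at h2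
    have h3 : (.mk (s ^ 2) (sq_nonneg s) * 1 : ℝ≥0) = v := NNReal.eq (by simp [hv])
    rw [h3, mul_zero, zero_add] at h2
    exact h2.symm
  have hpre : (fun x : ℝ => -m + s * x) ⁻¹' Set.Ioi 0 = (Set.Iic (m / s))ᶜ := by
    ext x
    simp [div_lt_iff₀ hs, mul_comm]
  rw [h, map_measureReal_apply (by fun_prop) measurableSet_Ioi, hpre,
    probReal_compl_eq_one_sub measurableSet_Iic, stdNormalCdf, cdf_eq_real]

theorem measureReal_Ioi_gaussianReal_add_neg (m : ℝ) {v : ℝ≥0} (hv : v ≠ 0) :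
    (gaussianReal m v).real (Set.Ioi 0) + (gaussianReal (-m) v).real (Set.Ioi 0) = 1 := by
  have := nullSingletonClass_gaussianReal (μ := m) hv
  have hpre : (fun x : ℝ => -x) ⁻¹' Set.Ioi 0 = Set.Iio 0 := by
    ext x
    simp
  have h : (gaussianReal m v).real (Set.Ioi 0)ᶜ = (gaussianReal m v).real (Set.Iio 0) := by
    rw [Set.compl_Ioi]
    exact (measureReal_congr Iio_ae_eq_Iic).symm
  rw [← gaussianReal_map_neg, map_measureReal_apply measurable_neg measurableSet_Ioi, hpre, ← h,
    probReal_compl_eq_one_sub measurableSet_Ioi]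
  ring

/-- Identifies the ratio G/H from the excess comparison with R; replacing m by -m gives H/G. -/
theorem normalOdds_div {s : ℝ} (hs : 0 < s) (m : ℝ) {v : ℝ≥0} (hv : (v : ℝ) = s ^ 2) :
    normalOdds (m / s) =
      (gaussianReal m v).real (Set.Ioi 0) / (gaussianReal (-m) v).real (Set.Ioi 0) := by
  have hv0 : v ≠ 0 := fun h => by
    rw [h] at hv
    have : 0 < s ^ 2 := by positivity
    simp only [NNReal.coe_zero] at hv
    linarith
  have h1 := one_sub_stdNormalCdf_div hs m hv
  have h2 := measureReal_Ioi_gaussianReal_add_neg m hv0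
  rw [normalOdds, h1]
  congr 1
  linarith

/-- The approximation is c(2p - 1)/m with p = e/(e + 1). Both 1 - P and 1 - p are at most 1/e, so P
and p differ little enough to absorb the factor c. -/
theorem abs_exitTime_sub_approx_le {m b c P T C k : ℝ} (hm : 0 < m) (hb : 0 < b) (hc : 0 < c)
    (hk : c = k * b) (hP1 : P ≤ 1) (hP2 : 1 - P ≤ (Real.exp b)⁻¹)
    (hT : |m * T - c * (2 * P - 1)| ≤ C) :
    |T - (2 * c * (Real.exp b - 1) / (m * (Real.exp b - Real.exp (-b))) - c / m)| ≤
      (C + 2 * k) / m := by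
  have he : 1 < Real.exp b := Real.one_lt_exp_iff.2 hb
  have hbe : b ≤ Real.exp b := by linarith [Real.add_one_le_exp b]
  rw [Real.exp_neg]
  set e := Real.exp b
  have he0 : 0 < e := by linarith
  have hk0 : 0 < k := by
    by_contra! h
    nlinarith
  have e1 : 2 * c * (e - 1) / (m * (e - e⁻¹)) - c / m = c * (2 * (e / (e + 1)) - 1) / m := by
    have h1 : e - e⁻¹ = (e - 1) * (e + 1) / e := by
      field_simp
      ring
    have h2 : e - 1 ≠ 0 := by linarith
    rw [h1]
    field_simp
  -- The growing factor c = kb is beaten by exp(b) ≥ b.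
  have hce : c * e⁻¹ ≤ k := by
    rw [← div_eq_mul_inv, div_le_iff₀ he0, hk]
    exact mul_le_mul_of_nonneg_left hbe hk0.le
  have hp : e / (e + 1) = 1 - (e + 1)⁻¹ := by
    field_simp
    ring
  have hq0 : 0 ≤ (e + 1)⁻¹ := by positivity
  have hq1 : (e + 1)⁻¹ ≤ e⁻¹ := inv_anti₀ he0 (by linarith)
  have hT' : T = m * T / m := by field_simp
  rw [e1, hp, hT', ← sub_div, abs_div, abs_of_pos hm]
  refine div_le_div_of_nonneg_right ?_ hm.le
  obtain ⟨h1, h2⟩ := abs_le.1 hT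
  rw [abs_le]
  constructor <;> nlinarith

theorem mainTheorem10 (μ σ : ℝ) (hμ : 0 < μ) (hσ : 0 < σ) :
    ∃ K : ℝ, ∀ (Ω : Type*) [MeasurableSpace Ω] (P : Measure Ω) [IsProbabilityMeasure P]
      (V : ℕ → Ω → ℝ), (∀ i, Measurable (V i)) → iIndepFun V P →
      (∀ i, P.map (V i) = gaussianReal μ (Real.toNNReal (2 * σ ^ 2))) →
      ∀ c : ℝ, 0 < c →
        (∀ᵐ ω ∂P, exitTime V c ω ≠ ⊤) ∧
        (Real.exp (μ * c / σ ^ 2) - 1) /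
            (Real.exp (μ * c / σ ^ 2)
              - normalOdds (-(μ / (σ * Real.sqrt 2))) * Real.exp (-(μ * c / σ ^ 2)))
          < P.real (upperExit V c) ∧
        P.real (upperExit V c)
          < (Real.exp (μ * c / σ ^ 2) * normalOdds (μ / (σ * Real.sqrt 2)) - 1) /
            (Real.exp (μ * c / σ ^ 2) * normalOdds (μ / (σ * Real.sqrt 2))
              - Real.exp (-(μ * c / σ ^ 2))) ∧
        expectedExitTime P V c ≠ ⊤ ∧
        |(expectedExitTime P V c).toReal - approxExitTime μ σ c| ≤ K := by
  set v : ℝ≥0 := Real.toNNReal (2 * σ ^ 2) with hvdef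
  have hvr : (v : ℝ) = 2 * σ ^ 2 := Real.coe_toNNReal _ (by positivity)
  have hv : v ≠ 0 := fun h => by
    rw [h] at hvr
    have : 0 < 2 * σ ^ 2 := by positivity
    simp only [NNReal.coe_zero] at hvr
    linarith
  have hs : 0 < σ * Real.sqrt 2 := by positivity
  have hvs : (v : ℝ) = (σ * Real.sqrt 2) ^ 2 := by
    rw [hvr, mul_pow, Real.sq_sqrt (by norm_num)]
    ring
  -- The first term bounds the mean excess; in the second, σ²/μ is the ratio of c to the exponent
  -- μc/σ².
  refine ⟨(excessBound μ v + 2 * (σ ^ 2 / μ)) / μ, ?_⟩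
  intro Ω _ P _ V hV hind hγ c hc
  obtain ⟨sa, Q, hQ, h1, h2, h3, h4, h5⟩ := killedLaw_exit hμ hv hc
  rw [← measureReal_upperExit hV hind hγ] at hQ
  subst hQ
  have hb : 2 * μ / v * c = μ * c / σ ^ 2 := by
    rw [hvr]
    field_simp
  have hT := expectedExitTime_eq_ofReal hV hind hγ sa
  have hT' : expectedExitTime P V c ≠ ⊤ := by
    rw [hT]
    exact ENNReal.ofReal_ne_top
  rw [hb] at h1 h2 h4
  rw [normalOdds_div hs μ hvs, ← neg_div, normalOdds_div hs (-μ) hvs, neg_neg]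
  refine ⟨exitTime_ne_top_ae hV hT', ?_, ?_, hT', ?_⟩
  · rwa [Real.exp_neg]
  · rwa [Real.exp_neg]
  · rw [hT, ENNReal.toReal_ofReal (tsum_nonneg fun n => measureReal_nonneg)]
    exact abs_exitTime_sub_approx_le hμ (by positivity) hc (by field_simp) h3 h4 h5
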